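/- For $n\ge 0$ let $S_n$ be the set of permutations $\pi=a_1a_2\cdots a_n$ of $\{1,\dots,n\}$, and put $\operatorname{maj}\pi=\sum_{a_i>a_{i+1}} i$ and $\operatorname{inv}\pi=\#\{(i,j): i<j,\ a_i>a_j\}$. For nonnegative integers $i,j$ let $$b_n(i,j)=\#\{\pi\in S_n:\ \operatorname{maj}\pi\equiv i \ (\mathrm{mod}\ 2),\ \operatorname{maj}\pi^{-1}\equiv j\ (\mathrm{mod}\ 2)\},$$ $$B_n(i,j)=\{\pi\in S_n:\ \operatorname{inv}\pi\equiv i\ (\mathrm{mod}\ 2),\ \operatorname{maj}\pi^{-1}\equiv j\ (\mathrm{mod}\ 2)\}.$$ For $\pi\in S_2$, a set $\Gamma$ of positive integers and a set $N\subseteq S_{n-2}$, let $\pi\sqcup\!\sqcup_\Gamma^+ N\subseteq S_n$ be the set of all permutations that are a shuffle of $\pi$ with a word obtained by adding $2$ to every letter of some $\sigma\in N$, and in which the difference of the positions of the second and the first letter of $\pi$ belongs to $\Gamma$. Let $O=\{1,3,5,\dots\}$ and $E=\{2,4,6,\dots\}$. **Theorem.** Let $n\ge2$. Then $\#B_n(i,j)=b_n(i,j)$,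 and the following hold for all $i,j\ge 0$. 1. There is the disjoint union $$B_n(i,j)=\left(12\sqcup\!\sqcup_O^+ B_{n-2}(i,j)\right)\uplus\left(12\sqcup\!\sqcup_E^+ B_{n-2}(i+1,j)\right)\uplus\left(21\sqcup\!\sqcup_E^+ B_{n-2}(i,j+1)\right)\uplus\left(21\sqcup\!\sqcup_O^+ B_{n-2}(i+1,j+1)\right).$$ 2. $b_{2n}(i,j)=2n^2\,b_{2n-2}(i,j)+2n(n-1)\,b_{2n-2}(i+1,j)$ and $b_{2n+1}(i,j)=2n(n+1)\,b_{2n-1}(i,j)+2n^2\,b_{2n-1}(i+1,j)$. 3. For $k\ge1$ put $c_{2k}=b_{2k}/(2^{k-1}k!)$ and $c_{2k+1}=b_{2k+1}/(2^{k-1}k!)$. The matrices $c_n$, $c_{2n}$ and $c_{2n+1}$ have integer entries, and $$c_{2n}(i,j)=n\,c_{2n-2}(i,j)+(n-1)\,c_{2n-2}(i+1,j),\qquad c_{2n+1}(i,j)=(n+1)\,c_{2n-1}(i,j)+n\,c_{2n-1}(i+1,j).$$ 4. $b_n(i,j)=b_n(i+1,j+1)$. 5. $b_{2n}(i,j)=2n\,b_{2n-1}(i,j)$.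 -/

import Mathlib

namespace MajShuffle

/-- The one-line word `a_1 a_2 … a_n` of a permutation `π`. Positions are indexed from `0` by
`Fin n`; the letters are the elements of `{1, …, n}`. -/
def word {n : ℕ} (π : Equiv.Perm (Fin n)) : Fin n → ℕ := fun p => (π p : ℕ) + 1

/-- The major index: the sum of all `i ∈ {1, …, n - 1}` with `a_i > a_{i+1}`. The (one-based)
index `i` is `p + 1` for the position `p : Fin n`. -/
def maj {n : ℕ} (π : Equiv.Perm (Fin n)) : ℕ :=
  ∑ p : Fin n, if ∃ h : (p : ℕ) + 1 < n, word π ⟨(p : ℕ) + 1, h⟩ < word π p then (p : ℕ) + 1 else 0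

/-- The inversion number. -/
def inv {n : ℕ} (π : Equiv.Perm (Fin n)) : ℕ :=
  (Finset.univ.filter fun p : Fin n × Fin n => p.1 < p.2 ∧ word π p.2 < word π p.1).card

/-- `m_n^{k,l}(i,j) = #{π ∈ S_n : maj π ≡ i (mod k) and maj π⁻¹ ≡ j (mod l)}`. -/
def m (k l n i j : ℕ) : ℕ :=
  (Finset.univ.filter fun π : Equiv.Perm (Fin n) =>
    maj π ≡ i [MOD k] ∧ maj π⁻¹ ≡ j [MOD l]).card

/-- `M_n^{k,l}(i,j) = {π ∈ S_n : inv π ≡ i (mod k) and maj π⁻¹ ≡ j (mod l)}`. -/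
def M (k l n i j : ℕ) : Set (Equiv.Perm (Fin n)) :=
  {π | inv π ≡ i [MOD k] ∧ maj π⁻¹ ≡ j [MOD l]}

/-- `b_n = m_n^{2,2}`. -/
def b (n i j : ℕ) : ℕ := m 2 2 n i j

/-- `B_n = M_n^{2,2}`. -/
def B (n i j : ℕ) : Set (Equiv.Perm (Fin n)) := M 2 2 n i j

/-- `c_{2n} = b_{2n} / (2^{n-1} n!)` and `c_{2n+1} = b_{2n+1} / (2^{n-1} n!)` for `n ≥ 1`: in both
cases `n` is the integer part of half the index. -/
def c (N i j : ℕ) : ℚ := (b N i j : ℚ) / ((2 ^ (N / 2 - 1) * (N / 2).factorial : ℕ) : ℚ)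

/-- `w` is a shuffle of the sequences `u` and `v`, with the terms of `u` at the positions
`f 0 < f 1 < …` and those of `v`, in order, at all the remaining positions `g 0 < g 1 < …`. -/
def IsShuffleAt {r s n : ℕ} (u : Fin r → ℕ) (v : Fin s → ℕ) (w : Fin n → ℕ)
    (f : Fin r → Fin n) (g : Fin s → Fin n) : Prop :=
  StrictMono f ∧ StrictMono g ∧ IsCompl (Set.range f) (Set.range g) ∧
    (∀ a, w (f a) = u a) ∧ (∀ a, w (g a) = v a)

/-- The restricted shuffle of `π ∈ S_{r+1}` and `σ ∈ S_s` for the gaps `γ = (g_1, …, g_r)`, as a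
set of permutations `τ ∈ S_n`: the word of `τ` is a shuffle of the word of `π` and of the
word of `σ` with `r + 1 = |π|` added to every letter, such that the letters of `π` are at positions
`i_1 < … < i_{r+1}` with `i_{t+1} - i_t = g_t`. (It is empty unless `n = (r + 1) + s`.) -/
def gapShuffle {r s : ℕ} (n : ℕ) (π : Equiv.Perm (Fin (r + 1))) (γ : Fin r → ℕ)
    (σ : Equiv.Perm (Fin s)) : Set (Equiv.Perm (Fin n)) :=
  {τ | ∃ f g, IsShuffleAt (word π) (fun a => word σ a + (r + 1)) (word τ) f g ∧
    ∀ t : Fin r, (f t.succ : ℕ) = (f t.castSucc : ℕ) + γ t}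

/-- The restricted shuffle of `π` with a set `N` of permutations, for a set `Γ` of compositions:
the union of all `gapShuffle n π γ σ` with `γ ∈ Γ` and `σ ∈ N`. -/
def gapShuffleSet {r s : ℕ} (n : ℕ) (π : Equiv.Perm (Fin (r + 1))) (Γ : Set (Fin r → ℕ))
    (N : Set (Equiv.Perm (Fin s))) : Set (Equiv.Perm (Fin n)) :=
  ⋃ γ ∈ Γ, ⋃ σ ∈ N, gapShuffle n π γ σ

/-- The union over `Γ` in `gapShuffleSet` is a disjoint union. -/
theorem gapShuffle_disjoint {r s : ℕ} (n : ℕ) (π : Equiv.Perm (Fin (r + 1)))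
    (γ γ' : Fin r → ℕ) (hγ : γ ≠ γ') (σ σ' : Equiv.Perm (Fin s)) :
    Disjoint (gapShuffle n π γ σ) (gapShuffle n π γ' σ') := by
  rw [Set.disjoint_left]
  rintro τ ⟨f, g, ⟨-, -, -, hf, -⟩, h⟩ ⟨f', g', ⟨-, -, -, hf', -⟩, h'⟩
  apply hγ
  have e : f = f' := by
    funext a
    have := (hf a).trans (hf' a).symm
    simp only [word] at this
    exact τ.injective (Fin.ext (by omega))
  subst e
  funext t
  have := h t
  have := h' t
  omega

/-- `O = {1, 3, 5, …}`, as a set of compositions with one part. -/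
def O : Set (Fin 1 → ℕ) := {γ | Odd (γ 0)}

/-- `E = {2, 4, 6, …}`, as a set of compositions with one part. -/
def E : Set (Fin 1 → ℕ) := {γ | 0 < γ 0 ∧ Even (γ 0)}

/-- The permutation `12` in `S_2`. -/
def p12 : Equiv.Perm (Fin 2) := 1

/-- The permutation `21` in `S_2`. -/
def p21 : Equiv.Perm (Fin 2) := Equiv.swap 0 1

end MajShuffle

open MajShuffle

namespace MajShuffle

/-! Modulo 2, `maj` only sees descents inside the blocks of zero-based positions `2l`, `2l + 1`,
while `(-1)^inv` is the sign. Fourier inversion on parities gives `four_mul_b`: exchanging the two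
smallest letters kills the sums of `(-1)^maj` and `(-1)^inv` separately, so four times a count is
`n!` plus or minus one mixed signed sum.

Both mixed sums, `signedMaj` and `signedInv`, get multiplied by `2⌊(n+2)/2⌋` from `n` to `n + 2`.
For `maj` the exchange cancels every permutation whose two smallest letters lie in different blocks;
for `inv` an alternating sum over insertion positions is evaluated. Equal initial values give
`ncard_B`, and the recurrences for `b` and `c` are then linear algebra.

The decomposition of `B` is finer: in `insertTwo p q σ` the parities of `inv` and of the inverse
`maj` change by amounts depending only on the order of the two inserted letters and the parity of
their gap. -/

/-! ### Parities of `maj` and `inv` as signs -/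

/-- The sign of the comparison of two consecutive entries: `-1` for a descent. -/
def desSign {n : ℕ} (a b : Fin n) : ℤ := if b < a then -1 else 1

/-- Descents at even one-based indices do not affect parity. For odd `n` the last position lies in
no block, but it has no successor either. -/
theorem neg_one_pow_maj {n : ℕ} (ρ : Equiv.Perm (Fin n)) (k : ℕ) (hk : n / 2 = k) :
    (-1 : ℤ) ^ maj ρ =
      ∏ l : Fin k, desSign (ρ ⟨2 * l, by omega⟩) (ρ ⟨2 * l + 1, by omega⟩) := by
  unfold maj
  rw [← Finset.prod_pow_eq_pow_sum]
  symm
  apply Fintype.prod_of_injective (fun l : Fin k => (⟨2 * l, by omega⟩ : Fin n))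
  · intro a b h
    simp only [Fin.mk.injEq] at h
    ext
    omega
  · intro p hp
    split_ifs with h
    · obtain ⟨h, -⟩ := h
      apply Even.neg_one_pow
      rw [Nat.even_add_one]
      rintro ⟨r, hr⟩
      exact hp ⟨⟨r, by omega⟩, Fin.ext (by simp only; omega)⟩
    · rfl
  · intro l
    have hl : 2 * (l : ℕ) + 1 < n := by omega
    have ho : (-1 : ℤ) ^ (2 * (l : ℕ) + 1) = -1 := Odd.neg_one_pow ⟨l, rfl⟩
    simp only [desSign, word, hl, exists_true_left, add_lt_add_iff_right, Fin.val_fin_lt]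
    split_ifs <;> simp [ho]

theorem neg_one_pow_inv {n : ℕ} (π : Equiv.Perm (Fin n)) :
    (-1 : ℤ) ^ inv π = (Equiv.Perm.sign π : ℤ) := by
  rw [Equiv.Perm.sign_eq_prod_prod_Ioi, inv, ← Finset.prod_const, Finset.prod_filter,
    Fintype.prod_prod_type, Units.coe_prod]
  refine Finset.prod_congr rfl fun i _ => ?_
  rw [Units.coe_prod, ← Finset.prod_subset (Finset.subset_univ (Finset.Ioi i))]
  · refine Finset.prod_congr rfl fun j hj => ?_
    rw [Finset.mem_Ioi] at hj
    have : π i ≠ π j := fun h => hj.ne (π.injective h)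
    simp only [hj, word, true_and, add_lt_add_iff_right, Fin.val_fin_lt]
    rcases lt_or_gt_of_ne this with h | h
    · simp [h, h.not_gt]
    · simp [h, h.not_gt]
  · intro j _ hj
    rw [Finset.mem_Ioi] at hj
    simp [hj]

/-- Deleting a block of two positions whose complement is enumerated by `x`. -/
theorem neg_one_pow_maj_delete {n : ℕ} (ρ : Equiv.Perm (Fin (n + 2))) (ρ' : Equiv.Perm (Fin n))
    (l : Fin (n / 2 + 1)) (x y : Fin n → Fin (n + 2)) (hy : StrictMono y)
    (hx : ∀ a, ((x a : ℕ) = if (a : ℕ) < 2 * l then (a : ℕ) else a + 2))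
    (h : ∀ a, ρ (x a) = y (ρ' a)) :
    (-1 : ℤ) ^ maj ρ =
      desSign (ρ ⟨2 * l, by omega⟩) (ρ ⟨2 * l + 1, by omega⟩) * (-1) ^ maj ρ' := by
  rw [neg_one_pow_maj ρ (n / 2 + 1) (by omega), neg_one_pow_maj ρ' _ rfl,
    Fin.prod_univ_succAbove _ l]
  congr 1
  refine Finset.prod_congr rfl fun k _ => ?_
  -- Blocks other than `l` keep their place or move by a whole block, so `x` carries blocks to
  -- blocks.
  have hs : ((l.succAbove k : Fin (n / 2 + 1)) : ℕ) = if (k : ℕ) < l then (k : ℕ) else k + 1 := by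
    simp only [Fin.succAbove, Fin.lt_def, Fin.val_castSucc]
    split_ifs <;> rfl
  have e1 : (⟨2 * (l.succAbove k : Fin (n / 2 + 1)), by omega⟩ : Fin (n + 2)) =
      x ⟨2 * k, by omega⟩ := by
    ext
    rw [hx]
    simp only [hs]
    split_ifs <;> omega
  have e2 : (⟨2 * (l.succAbove k : Fin (n / 2 + 1)) + 1, by omega⟩ : Fin (n + 2)) =
      x ⟨2 * k + 1, by omega⟩ := by
    ext
    rw [hx]
    simp only [hs]
    split_ifs <;> omega
  rw [e1, e2, h, h]
  simp [desSign, hy.lt_iff_lt]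

/-! ### Insertion of the two smallest letters -/

/-- The permutation with smallest letter at position `p` whose other letters form `σ`. -/
def insertMin {n : ℕ} (p : Fin (n + 1)) (σ : Equiv.Perm (Fin n)) : Equiv.Perm (Fin (n + 1)) :=
  Equiv.Perm.decomposeFin.symm (0, σ) * Fin.cycleRange p

theorem insertMin_self {n : ℕ} (p : Fin (n + 1)) (σ : Equiv.Perm (Fin n)) :
    insertMin p σ p = 0 := by
  simp [insertMin]

theorem insertMin_succAbove {n : ℕ} (p : Fin (n + 1)) (σ : Equiv.Perm (Fin n)) (a : Fin n) :
    insertMin p σ (p.succAbove a) = (σ a).succ := by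
  simp [insertMin]

theorem sign_insertMin {n : ℕ} (p : Fin (n + 1)) (σ : Equiv.Perm (Fin n)) :
    Equiv.Perm.sign (insertMin p σ) = (-1) ^ (p : ℕ) * Equiv.Perm.sign σ := by
  simp [insertMin, Equiv.Perm.decomposeFin.symm_sign, mul_comm]

theorem insertMin_bijective (n : ℕ) :
    Function.Bijective fun x : Fin (n + 1) × Equiv.Perm (Fin n) => insertMin x.1 x.2 := by
  rw [Fintype.bijective_iff_injective_and_card]
  constructor
  · rintro ⟨p, σ⟩ ⟨p', σ'⟩ h
    simp only at h
    have hp : p = p' := by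
      apply (insertMin p σ).injective
      rw [insertMin_self, h, insertMin_self]
    subst hp
    congr 1
    ext a
    have := congrArg (fun τ => τ (p.succAbove a)) h
    simp only [insertMin_succAbove, Fin.succ_inj] at this
    rw [this]
  · simp [Fintype.card_perm, Nat.factorial_succ]

/-- The permutation with the letter `0` at position `p`, the letter `1` at position
`p.succAbove q`, and whose other letters form `σ`. -/
def insertTwo {n : ℕ} (p : Fin (n + 2)) (q : Fin (n + 1)) (σ : Equiv.Perm (Fin n)) :
    Equiv.Perm (Fin (n + 2)) := insertMin p (insertMin q σ)

/-- The positions of the letters other than `0` and `1` in `insertTwo p q σ`. -/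
def restPos {n : ℕ} (p : Fin (n + 2)) (q : Fin (n + 1)) (a : Fin n) : Fin (n + 2) :=
  p.succAbove (q.succAbove a)

theorem restPos_strictMono {n : ℕ} (p : Fin (n + 2)) (q : Fin (n + 1)) :
    StrictMono (restPos p q) :=
  (Fin.strictMono_succAbove p).comp (Fin.strictMono_succAbove q)

theorem range_restPos {n : ℕ} (p : Fin (n + 2)) (q : Fin (n + 1)) :
    Set.range (restPos p q) = {p, p.succAbove q}ᶜ := by
  ext x
  simp only [Set.mem_range, restPos, Set.mem_compl_iff, Set.mem_insert_iff, Set.mem_singleton_iff]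
  constructor
  · rintro ⟨a, rfl⟩
    simp [Fin.succAbove_ne]
  · intro hx
    push Not at hx
    obtain ⟨y, rfl⟩ := Fin.exists_succAbove_eq hx.1
    obtain ⟨a, rfl⟩ := Fin.exists_succAbove_eq (fun h : y = q => hx.2 (h ▸ rfl))
    exact ⟨a, rfl⟩

theorem insertTwo_fst {n : ℕ} (p : Fin (n + 2)) (q : Fin (n + 1)) (σ : Equiv.Perm (Fin n)) :
    insertTwo p q σ p = 0 := insertMin_self _ _

theorem insertTwo_snd {n : ℕ} (p : Fin (n + 2)) (q : Fin (n + 1)) (σ : Equiv.Perm (Fin n)) :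
    insertTwo p q σ (p.succAbove q) = 1 := by
  rw [insertTwo, insertMin_succAbove, insertMin_self]
  rfl

theorem insertTwo_restPos {n : ℕ} (p : Fin (n + 2)) (q : Fin (n + 1)) (σ : Equiv.Perm (Fin n))
    (a : Fin n) : insertTwo p q σ (restPos p q a) = (σ a).succ.succ := by
  rw [insertTwo, restPos, insertMin_succAbove, insertMin_succAbove]

theorem sum_perm_eq_sum_insertMin {n : ℕ} (F : Equiv.Perm (Fin (n + 1)) → ℤ) :
    ∑ τ, F τ = ∑ p, ∑ σ, F (insertMin p σ) := by
  rw [← (insertMin_bijective n).sum_comp, Fintype.sum_prod_type]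

theorem sum_perm_eq_sum_insertTwo {n : ℕ} (F : Equiv.Perm (Fin (n + 2)) → ℤ) :
    ∑ τ, F τ = ∑ p, ∑ q, ∑ σ, F (insertTwo p q σ) := by
  rw [sum_perm_eq_sum_insertMin]
  exact Finset.sum_congr rfl fun p _ => sum_perm_eq_sum_insertMin fun τ => F (insertMin p τ)

theorem exists_insertTwo_eq {n : ℕ} (τ : Equiv.Perm (Fin (n + 2))) :
    ∃ p q σ, insertTwo p q σ = τ := by
  obtain ⟨⟨p, τ'⟩, rfl⟩ := (insertMin_bijective (n + 1)).surjective τ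
  obtain ⟨⟨q, σ⟩, rfl⟩ := (insertMin_bijective n).surjective τ'
  exact ⟨p, q, σ, rfl⟩

theorem val_succAbove {n : ℕ} (p : Fin (n + 1)) (q : Fin n) :
    ((p.succAbove q : Fin (n + 1)) : ℕ) = if (q : ℕ) < p then (q : ℕ) else q + 1 := by
  simp only [Fin.succAbove, Fin.lt_def, Fin.val_castSucc]
  split_ifs <;> rfl

theorem sign_insertTwo {n : ℕ} (p : Fin (n + 2)) (q : Fin (n + 1)) (σ : Equiv.Perm (Fin n)) :
    (-1 : ℤ) ^ inv (insertTwo p q σ) = (-1) ^ (p + q : ℕ) * (-1) ^ inv σ := by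
  rw [neg_one_pow_inv, neg_one_pow_inv, insertTwo, sign_insertMin, sign_insertMin]
  push_cast
  ring

/-- In the inverse, the letters `0` and `1` become the first block of positions, which can always be
deleted; it is a descent exactly when `1` precedes `0`. -/
theorem imaj_insertTwo {n : ℕ} (p : Fin (n + 2)) (q : Fin (n + 1)) (σ : Equiv.Perm (Fin n)) :
    (-1 : ℤ) ^ maj (insertTwo p q σ)⁻¹ = (if (q : ℕ) < p then -1 else 1) * (-1) ^ maj σ⁻¹ := by
  rw [neg_one_pow_maj_delete (insertTwo p q σ)⁻¹ σ⁻¹ 0 (fun a => a.succ.succ) (restPos p q)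
    (restPos_strictMono p q) (by simp)]
  · have h0 : (insertTwo p q σ)⁻¹ 0 = p := by
      rw [Equiv.Perm.inv_eq_iff_eq, insertTwo_fst]
    have h1 : (insertTwo p q σ)⁻¹ 1 = p.succAbove q := by
      rw [Equiv.Perm.inv_eq_iff_eq, insertTwo_snd]
    congr 1
    change desSign ((insertTwo p q σ)⁻¹ 0) ((insertTwo p q σ)⁻¹ 1) = _
    simp only [h0, h1, desSign, Fin.lt_def, val_succAbove]
    split_ifs <;> first | rfl | omega
  · intro a
    rw [Equiv.Perm.inv_eq_iff_eq, insertTwo_restPos]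
    simp

/-- When the two letters fill a block, the sign picked up is the one in `imaj_insertTwo`, so the two
cancel in the mixed sum. -/
theorem maj_insertTwo {n : ℕ} (p : Fin (n + 2)) (q : Fin (n + 1)) (σ : Equiv.Perm (Fin n))
    (l : Fin (n / 2 + 1)) (hq : (q : ℕ) = 2 * l) (hp : (p : ℕ) = 2 * l ∨ (p : ℕ) = 2 * l + 1) :
    (-1 : ℤ) ^ maj (insertTwo p q σ) = (if (q : ℕ) < p then -1 else 1) * (-1) ^ maj σ := by
  rw [neg_one_pow_maj_delete (insertTwo p q σ) σ l (restPos p q) (fun a => a.succ.succ)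
    (fun a b h => by simpa using h) _ (insertTwo_restPos p q σ)]
  · congr 1
    have hs := val_succAbove p q
    rcases hp with hp | hp
    · rw [if_neg (by omega)] at hs ⊢
      have h0 : (⟨2 * l, by omega⟩ : Fin (n + 2)) = p := Fin.ext hp.symm
      have h1 : (⟨2 * l + 1, by omega⟩ : Fin (n + 2)) = p.succAbove q := Fin.ext (by simp [hs, hq])
      rw [h0, h1, insertTwo_fst, insertTwo_snd]
      simp [desSign]
    · rw [if_pos (by omega)] at hs ⊢
      have h0 : (⟨2 * l + 1, by omega⟩ : Fin (n + 2)) = p := Fin.ext hp.symm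
      have h1 : (⟨2 * l, by omega⟩ : Fin (n + 2)) = p.succAbove q := Fin.ext (by simp [hs, hq])
      rw [h0, h1, insertTwo_fst, insertTwo_snd]
      simp [desSign]
  · intro a
    rw [restPos, val_succAbove, val_succAbove]
    split_ifs <;> omega

/-! ### Exchanging the two smallest letters -/

theorem swap_mul_inv_apply {n : ℕ} (τ : Equiv.Perm (Fin (n + 2))) (x : Fin (n + 2)) :
    (Equiv.swap 0 1 * τ : Equiv.Perm (Fin (n + 2)))⁻¹ x = τ⁻¹ (Equiv.swap 0 1 x) := by
  simp [mul_inv_rev]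

theorem desSign_comm {n : ℕ} {a b : Fin n} (h : b ≠ a) : desSign a b = -desSign b a := by
  rcases lt_or_gt_of_ne h with h | h <;> simp [desSign, h, h.not_gt]

theorem neg_one_pow_imaj_swap_mul {n : ℕ} (τ : Equiv.Perm (Fin (n + 2))) :
    (-1 : ℤ) ^ maj (Equiv.swap 0 1 * τ)⁻¹ = -(-1) ^ maj τ⁻¹ := by
  rw [neg_one_pow_maj _ (n / 2 + 1) (by omega), neg_one_pow_maj _ (n / 2 + 1) (by omega),
    Fin.prod_univ_succ, Fin.prod_univ_succ, ← neg_mul]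
  simp only [swap_mul_inv_apply]
  congr 1
  change desSign (τ⁻¹ (Equiv.swap 0 1 0)) (τ⁻¹ (Equiv.swap 0 1 1)) =
    -desSign (τ⁻¹ 0) (τ⁻¹ 1)
  rw [Equiv.swap_apply_left, Equiv.swap_apply_right, desSign_comm]
  exact fun h => by simpa using τ⁻¹.injective h

theorem neg_one_pow_inv_swap_mul {n : ℕ} (τ : Equiv.Perm (Fin (n + 2))) :
    (-1 : ℤ) ^ inv (Equiv.swap 0 1 * τ) = -(-1) ^ inv τ := by
  rw [neg_one_pow_inv, neg_one_pow_inv, Equiv.Perm.sign_mul, Equiv.Perm.sign_swap (by simp)]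
  simp

/-- No value lies between `0` and `1`, so exchanging them alters only their comparison with each
other. -/
theorem desSign_swap {n : ℕ} (a b : Fin (n + 2)) (h0 : a = 0 → b ≠ 1) (h1 : a = 1 → b ≠ 0) :
    desSign (Equiv.swap 0 1 a) (Equiv.swap 0 1 b) = desSign a b := by
  unfold desSign
  congr 1
  simp only [Equiv.swap_apply_def, eq_iff_iff]
  simp only [Fin.ext_iff, Fin.val_zero, Fin.val_one, ne_eq] at h0 h1 ⊢
  split_ifs <;> simp only [Fin.lt_def, Fin.val_zero, Fin.val_one] <;> omega

/-- The letters `0` and `1` occupy a pair of positions `2l`, `2l + 1`. -/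
def Paired {n : ℕ} (τ : Equiv.Perm (Fin (n + 2))) : Prop :=
  (τ⁻¹ 0 : ℕ) / 2 = (τ⁻¹ 1 : ℕ) / 2

instance {n : ℕ} : DecidablePred (@Paired n) := fun _ => inferInstanceAs (Decidable (_ = _))

theorem paired_swap_mul {n : ℕ} (τ : Equiv.Perm (Fin (n + 2))) :
    Paired (Equiv.swap 0 1 * τ) ↔ Paired τ := by
  simp only [Paired, swap_mul_inv_apply, Equiv.swap_apply_left, Equiv.swap_apply_right]
  exact eq_comm

theorem neg_one_pow_maj_swap_mul {n : ℕ} (τ : Equiv.Perm (Fin (n + 2))) (hτ : ¬ Paired τ) :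
    (-1 : ℤ) ^ maj (Equiv.swap 0 1 * τ) = (-1) ^ maj τ := by
  rw [neg_one_pow_maj _ _ rfl, neg_one_pow_maj _ _ rfl]
  refine Finset.prod_congr rfl fun k _ => ?_
  rw [Equiv.Perm.mul_apply, Equiv.Perm.mul_apply, desSign_swap] <;>
  · intro h h'
    apply hτ
    rw [← Equiv.Perm.eq_inv_iff_eq] at h h'
    rw [Paired, ← h, ← h']
    simp only
    omega

theorem sum_eq_zero_of_swap_mul {n : ℕ} (F : Equiv.Perm (Fin (n + 2)) → ℤ)
    (hF : ∀ τ, F (Equiv.swap 0 1 * τ) = -F τ) : ∑ τ, F τ = 0 := by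
  have h := Equiv.sum_comp (Equiv.mulLeft (Equiv.swap (0 : Fin (n + 2)) 1)) F
  simp only [Equiv.coe_mulLeft, hF, Finset.sum_neg_distrib] at h
  omega

theorem sum_imaj (n : ℕ) : ∑ τ : Equiv.Perm (Fin (n + 2)), (-1 : ℤ) ^ maj τ⁻¹ = 0 :=
  sum_eq_zero_of_swap_mul _ neg_one_pow_imaj_swap_mul

theorem sum_maj (n : ℕ) : ∑ τ : Equiv.Perm (Fin (n + 2)), (-1 : ℤ) ^ maj τ = 0 := by
  rw [← sum_imaj n]
  exact (Equiv.sum_comp (Equiv.inv (Equiv.Perm (Fin (n + 2)))) fun τ => (-1 : ℤ) ^ maj τ).symm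

theorem sum_inv (n : ℕ) : ∑ τ : Equiv.Perm (Fin (n + 2)), (-1 : ℤ) ^ inv τ = 0 :=
  sum_eq_zero_of_swap_mul _ neg_one_pow_inv_swap_mul

/-! ### Sums over insertion positions -/

theorem paired_insertTwo {n : ℕ} (p : Fin (n + 2)) (q : Fin (n + 1)) (σ : Equiv.Perm (Fin n)) :
    Paired (insertTwo p q σ) ↔ Even (q : ℕ) ∧ ((p : ℕ) = q ∨ (p : ℕ) = q + 1) := by
  have h0 : (insertTwo p q σ)⁻¹ 0 = p := by
    rw [Equiv.Perm.inv_eq_iff_eq, insertTwo_fst]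
  have h1 : (insertTwo p q σ)⁻¹ 1 = p.succAbove q := by
    rw [Equiv.Perm.inv_eq_iff_eq, insertTwo_snd]
  rw [Paired, h0, h1, val_succAbove, Nat.even_iff]
  split_ifs <;> omega

/-- Each of the `⌊(n+2)/2⌋` blocks admits the two letters in two orders. -/
theorem card_paired_positions (n : ℕ) :
    ∑ p : Fin (n + 2), ∑ q : Fin (n + 1),
      (if Even (q : ℕ) ∧ ((p : ℕ) = q ∨ (p : ℕ) = q + 1) then (1 : ℤ) else 0) =
        2 * ((n + 2) / 2 : ℕ) := by
  rw [Finset.sum_comm]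
  have h (q : Fin (n + 1)) : ∑ p : Fin (n + 2),
      (if Even (q : ℕ) ∧ ((p : ℕ) = q ∨ (p : ℕ) = q + 1) then (1 : ℤ) else 0) =
        if Even (q : ℕ) then 2 else 0 := by
    split_ifs with hq
    · have : ∀ p : Fin (n + 2), (if Even (q : ℕ) ∧ ((p : ℕ) = q ∨ (p : ℕ) = q + 1) then (1 : ℤ)
          else 0) = (if p = q.castSucc then 1 else 0) + (if p = q.succ then 1 else 0) := by
        intro p
        simp only [hq, true_and, Fin.ext_iff, Fin.val_castSucc, Fin.val_succ]
        split_ifs <;> omega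
      simp only [this, Finset.sum_add_distrib, Finset.sum_ite_eq', Finset.mem_univ, if_true]
      rfl
    · simp [hq]
  simp only [h]
  rw [Fin.sum_univ_eq_sum_range (fun q => if Even q then (2 : ℤ) else 0)]
  clear h
  induction n with
  | zero => simp
  | succ n ih =>
    rw [Finset.sum_range_succ, ih]
    split_ifs with he <;> rw [Nat.even_iff] at he <;> omega

/-- Passing from `N` to `N + 1` adds a row, a column and a corner. The row and column together give
`(-1)^N` and the corner gives `1`: an increase of 2 exactly for even `N`. -/
theorem sum_alternating_positions (N : ℕ) :
    ∑ p ∈ Finset.range (N + 1), ∑ q ∈ Finset.range N,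
      (-1 : ℤ) ^ (p + q) * (if q < p then -1 else 1) = 2 * ((N + 1) / 2 : ℕ) := by
  induction N with
  | zero => simp
  | succ N ih =>
    rw [Finset.sum_range_succ]
    have e (p : ℕ) : ∑ q ∈ Finset.range (N + 1), (-1 : ℤ) ^ (p + q) * (if q < p then -1 else 1) =
        ∑ q ∈ Finset.range N, (-1 : ℤ) ^ (p + q) * (if q < p then -1 else 1) +
          (-1) ^ (p + N) * (if N < p then -1 else 1) := Finset.sum_range_succ _ N
    simp only [e, Finset.sum_add_distrib]
    rw [ih]
    have h1 : ∑ p ∈ Finset.range (N + 1), (-1 : ℤ) ^ (p + N) * (if N < p then -1 else 1) =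
        (-1) ^ N * ∑ p ∈ Finset.range (N + 1), (-1) ^ p := by
      rw [Finset.mul_sum]
      refine Finset.sum_congr rfl fun p hp => ?_
      rw [Finset.mem_range] at hp
      rw [if_neg (by omega)]
      ring
    have h2 : ∑ q ∈ Finset.range N, (-1 : ℤ) ^ (N + 1 + q) * (if q < N + 1 then -1 else 1) =
        (-1) ^ N * ∑ q ∈ Finset.range N, (-1) ^ q := by
      rw [Finset.mul_sum]
      refine Finset.sum_congr rfl fun p hp => ?_
      rw [Finset.mem_range] at hp
      rw [if_pos (by omega)]
      ring
    rw [h1, h2, neg_one_geom_sum, neg_one_geom_sum, if_pos (Nat.lt_succ_self N)]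
    have h3 : (-1 : ℤ) ^ (N + 1 + N) = -1 := Odd.neg_one_pow ⟨N, by ring⟩
    rw [h3]
    rcases Nat.even_or_odd N with h | h
    · have : ¬ Even (N + 1) := by simpa [Nat.even_add_one] using h
      rw [if_neg this, if_pos h, h.neg_one_pow]
      rw [Nat.even_iff] at h
      omega
    · have : Even (N + 1) := h.add_one
      rw [if_pos this, if_neg (Nat.not_even_iff_odd.2 h), h.neg_one_pow]
      rw [Nat.odd_iff] at h
      omega

/-! ### Recurrences for the mixed signed sums -/

/-- The signed count of `S_n` for the parity of `maj π + maj π⁻¹`. -/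
def signedMaj (n : ℕ) : ℤ := ∑ τ : Equiv.Perm (Fin n), (-1) ^ (maj τ + maj τ⁻¹)

/-- The signed count of `S_n` for the parity of `inv π + maj π⁻¹`. -/
def signedInv (n : ℕ) : ℤ := ∑ τ : Equiv.Perm (Fin n), (-1) ^ (inv τ + maj τ⁻¹)

theorem signedMaj_add_two (n : ℕ) :
    signedMaj (n + 2) = 2 * ((n + 2) / 2 : ℕ) * signedMaj n := by
  unfold signedMaj
  -- Sign-reversing involution: on unpaired permutations the exchange fixes the parity of `maj` and
  -- flips that of the inverse.
  have hz : ∑ τ : Equiv.Perm (Fin (n + 2)),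
      (if Paired τ then 0 else (-1 : ℤ) ^ (maj τ + maj τ⁻¹)) = 0 := by
    refine sum_eq_zero_of_swap_mul _ fun τ => ?_
    simp only [paired_swap_mul]
    split_ifs with h
    · simp
    · rw [pow_add, pow_add, neg_one_pow_maj_swap_mul τ h, neg_one_pow_imaj_swap_mul]
      ring
  have hs : ∑ τ : Equiv.Perm (Fin (n + 2)), (-1 : ℤ) ^ (maj τ + maj τ⁻¹) =
      ∑ τ : Equiv.Perm (Fin (n + 2)), (if Paired τ then (-1 : ℤ) ^ (maj τ + maj τ⁻¹) else 0) := by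
    refine sub_eq_zero.1 (Eq.trans ?_ hz)
    rw [← Finset.sum_sub_distrib]
    refine Finset.sum_congr rfl fun τ _ => ?_
    split_ifs <;> simp
  rw [hs, sum_perm_eq_sum_insertTwo, ← card_paired_positions, Finset.sum_mul]
  refine Finset.sum_congr rfl fun p _ => ?_
  rw [Finset.sum_mul]
  refine Finset.sum_congr rfl fun q _ => ?_
  rw [Finset.mul_sum]
  refine Finset.sum_congr rfl fun σ _ => ?_
  simp only [paired_insertTwo]
  split_ifs with h
  · obtain ⟨⟨l, hl⟩, hp⟩ := h
    have hq := q.2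
    rw [pow_add, maj_insertTwo p q σ ⟨l, by omega⟩ (by simp only; omega) (by simp only; omega),
      imaj_insertTwo, pow_add]
    split_ifs <;> ring
  · simp

theorem signedInv_add_two (n : ℕ) :
    signedInv (n + 2) = 2 * ((n + 2) / 2 : ℕ) * signedInv n := by
  unfold signedInv
  rw [sum_perm_eq_sum_insertTwo, ← sum_alternating_positions (n + 1), Finset.sum_mul,
    ← Fin.sum_univ_eq_sum_range (fun p => (∑ q ∈ Finset.range (n + 1),
      (-1 : ℤ) ^ (p + q) * (if q < p then -1 else 1)) * _)]
  refine Finset.sum_congr rfl fun p _ => ?_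
  rw [Finset.sum_mul, ← Fin.sum_univ_eq_sum_range
    (fun q => (-1 : ℤ) ^ (p + q : ℕ) * (if q < (p : ℕ) then -1 else 1) * _)]
  refine Finset.sum_congr rfl fun q _ => ?_
  rw [Finset.mul_sum]
  refine Finset.sum_congr rfl fun σ _ => ?_
  rw [pow_add, sign_insertTwo, imaj_insertTwo, pow_add _ (inv σ)]
  ring

theorem signedInv_eq_signedMaj : ∀ n, signedInv n = signedMaj n
  | 0 => by decide
  | 1 => by decide
  | n + 2 => by rw [signedInv_add_two, signedMaj_add_two, signedInv_eq_signedMaj n]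

/-! ### Fourier inversion on parity classes -/

/-- Each parity indicator is half of one plus a sign; this is the expanded product of two of them.
-/
theorem four_mul_ite_modEq (u v i j : ℕ) :
    (4 : ℤ) * (if u ≡ i [MOD 2] ∧ v ≡ j [MOD 2] then 1 else 0) =
      1 + (-1) ^ i * (-1) ^ u + (-1) ^ j * (-1) ^ v + (-1) ^ (i + j) * (-1) ^ (u + v) := by
  have h (u i : ℕ) : (-1 : ℤ) ^ i * (-1) ^ u = if u ≡ i [MOD 2] then 1 else -1 := by
    rw [← pow_add]
    split_ifs with h <;> rw [Nat.ModEq] at h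
    · exact Even.neg_one_pow (Nat.even_iff.2 (by omega))
    · exact Odd.neg_one_pow (Nat.odd_iff.2 (by omega))
  have e : (-1 : ℤ) ^ (i + j) * (-1) ^ (u + v) =
      ((-1) ^ i * (-1) ^ u) * ((-1) ^ j * (-1) ^ v) := by ring
  rw [e, h, h]
  by_cases h1 : u ≡ i [MOD 2] <;> by_cases h2 : v ≡ j [MOD 2] <;> simp [h1, h2]

theorem four_mul_card_parity {α : Type*} [Fintype α] (u v : α → ℕ) (i j : ℕ)
    (hu : ∑ x, (-1 : ℤ) ^ u x = 0) (hv : ∑ x, (-1 : ℤ) ^ v x = 0) :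
    (4 : ℤ) * ((Finset.univ.filter fun x => u x ≡ i [MOD 2] ∧ v x ≡ j [MOD 2]).card : ℤ) =
      Fintype.card α + (-1) ^ (i + j) * ∑ x, (-1 : ℤ) ^ (u x + v x) := by
  rw [Finset.card_filter]
  push_cast
  rw [Finset.mul_sum]
  simp only [four_mul_ite_modEq, Finset.sum_add_distrib, ← Finset.mul_sum, hu, hv]
  simp

theorem four_mul_b (n i j : ℕ) :
    (4 : ℤ) * b (n + 2) i j = (n + 2).factorial + (-1) ^ (i + j) * signedMaj (n + 2) := by
  rw [b, m, four_mul_card_parity _ _ _ _ (sum_maj n) (sum_imaj n), Fintype.card_perm,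
    Fintype.card_fin, signedMaj]

theorem ncard_B (n i j : ℕ) : (B (n + 2) i j).ncard = b (n + 2) i j := by
  have h : (4 : ℤ) * ((B (n + 2) i j).ncard : ℤ) = 4 * b (n + 2) i j := by
    rw [four_mul_b, ← signedInv_eq_signedMaj, B, M, Set.ncard_eq_toFinset_card',
      Set.toFinset_ofPred, four_mul_card_parity _ _ _ _ (sum_inv n) (sum_imaj n),
      Fintype.card_perm, Fintype.card_fin, signedInv]
  omega

/-! ### Restricted shuffles as insertions -/

section Membership

variable {n : ℕ} (p : Fin (n + 2)) (q : Fin (n + 1)) (σ : Equiv.Perm (Fin n))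
  (π : Equiv.Perm (Fin 2)) (u v : Fin (n + 2))

/-- Leaving `u`, `v` free, as the positions of the first and second letter of `π`, treats `12` and
`21` at once. The letters force `f`, and its complement forces `g`. -/
theorem insertTwo_mem_gapShuffle_iff (γ : Fin 1 → ℕ) (σ' : Equiv.Perm (Fin n))
    (huv : ({u, v} : Set (Fin (n + 2))) = {p, p.succAbove q})
    (hu : word (insertTwo p q σ) u = word π 0) (hv : word (insertTwo p q σ) v = word π 1) :
    insertTwo p q σ ∈ gapShuffle (n + 2) π γ σ' ↔ σ' = σ ∧ u < v ∧ (v : ℕ) = u + γ 0 := by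
  have hword : Function.Injective (word (insertTwo p q σ)) := fun a b h =>
    (insertTwo p q σ).injective (Fin.ext (by simpa [word] using h))
  constructor
  · rintro ⟨f, g, ⟨hf, hg, hfg, hfu, hgv⟩, hγ⟩
    have h0 : f 0 = u := hword ((hfu 0).trans hu.symm)
    have h1 : f 1 = v := hword ((hfu 1).trans hv.symm)
    have hr : Set.range f = {u, v} := by
      rw [← h0, ← h1]
      ext x
      simp [Fin.exists_fin_two, eq_comm]
    have hgr : g = restPos p q := by
      rw [← hg.range_inj (restPos_strictMono p q), range_restPos, ← huv, ← hr, hfg.compl_eq]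
    subst hgr
    refine ⟨?_, ?_, ?_⟩
    · ext a
      have := hgv a
      simp only [word, insertTwo_restPos, Fin.val_succ] at this
      omega
    · rw [← h0, ← h1]
      exact hf (by decide)
    · rw [← h0, ← h1]
      exact hγ 0
  · rintro ⟨rfl, hlt, hγ⟩
    refine ⟨![u, v], restPos p q, ⟨?_, restPos_strictMono p q, ?_, ?_, ?_⟩, ?_⟩
    · rw [Fin.strictMono_iff_lt_succ]
      intro i
      rw [Subsingleton.elim i 0]
      exact hlt
    · have hr : Set.range ![u, v] = {u, v} := by
        ext x
        simp [eq_comm, or_comm]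
      rw [range_restPos, ← huv, hr]
      exact isCompl_compl
    · rw [Fin.forall_fin_two]
      exact ⟨hu, hv⟩
    · intro a
      simp [word, insertTwo_restPos]
    · intro t
      rw [Subsingleton.elim t 0]
      exact hγ

theorem insertTwo_mem_gapShuffleSet_iff (Γ : Set (Fin 1 → ℕ)) (N : Set (Equiv.Perm (Fin n)))
    (huv : ({u, v} : Set (Fin (n + 2))) = {p, p.succAbove q})
    (hu : word (insertTwo p q σ) u = word π 0) (hv : word (insertTwo p q σ) v = word π 1) :
    insertTwo p q σ ∈ gapShuffleSet (n + 2) π Γ N ↔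
      σ ∈ N ∧ u < v ∧ (fun _ => (v : ℕ) - u) ∈ Γ := by
  simp only [gapShuffleSet, Set.mem_iUnion, exists_prop,
    insertTwo_mem_gapShuffle_iff p q σ π u v _ _ huv hu hv]
  constructor
  · rintro ⟨γ, hγ, σ', hσ', rfl, hlt, h⟩
    refine ⟨hσ', hlt, ?_⟩
    convert hγ using 1
    funext t
    rw [Subsingleton.elim t 0]
    omega
  · rintro ⟨hσ, hlt, hΓ⟩
    refine ⟨_, hΓ, σ, hσ, rfl, hlt, ?_⟩
    rw [Fin.lt_def] at hlt
    omega

theorem insertTwo_mem_p12 (Γ : Set (Fin 1 → ℕ)) (N : Set (Equiv.Perm (Fin n))) :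
    insertTwo p q σ ∈ gapShuffleSet (n + 2) p12 Γ N ↔
      σ ∈ N ∧ (p : ℕ) ≤ q ∧ (fun _ => (q + 1 - p : ℕ)) ∈ Γ := by
  rw [insertTwo_mem_gapShuffleSet_iff p q σ p12 p (p.succAbove q) Γ N rfl
    (by simp [word, insertTwo_fst, p12]) (by simp [word, insertTwo_snd, p12]), Fin.lt_def,
    val_succAbove]
  split_ifs with h
  · simp [h.not_ge, h.not_gt]
  · simp

theorem insertTwo_mem_p21 (Γ : Set (Fin 1 → ℕ)) (N : Set (Equiv.Perm (Fin n))) :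
    insertTwo p q σ ∈ gapShuffleSet (n + 2) p21 Γ N ↔
      σ ∈ N ∧ (q : ℕ) < p ∧ (fun _ => (p - q : ℕ)) ∈ Γ := by
  rw [insertTwo_mem_gapShuffleSet_iff p q σ p21 (p.succAbove q) p Γ N (Set.pair_comm _ _)
    (by simp [word, insertTwo_snd, p21]) (by simp [word, insertTwo_fst, p21]), Fin.lt_def,
    val_succAbove]
  split_ifs with h
  · simp
  · simp [h]
    omega

theorem insertTwo_mem_B (i j : ℕ) :
    insertTwo p q σ ∈ B (n + 2) i j ↔
      (p + q + inv σ : ℕ) ≡ i [MOD 2] ∧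
        (if (q : ℕ) < p then maj σ⁻¹ + 1 else maj σ⁻¹) ≡ j [MOD 2] := by
  have parity (a c : ℕ) (h : (-1 : ℤ) ^ a = (-1) ^ c) : a % 2 = c % 2 := by
    rcases Nat.even_or_odd a with ha | ha <;> rcases Nat.even_or_odd c with hc | hc <;>
      simp only [ha.neg_one_pow, hc.neg_one_pow] at h <;>
      first
        | omega
        | (simp only [Nat.even_iff, Nat.odd_iff] at ha hc; omega)
  have h1 := sign_insertTwo p q σ
  rw [← pow_add] at h1
  have h2 := imaj_insertTwo p q σ
  have h3 : (-1 : ℤ) ^ maj (insertTwo p q σ)⁻¹ =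
      (-1) ^ (if (q : ℕ) < p then maj σ⁻¹ + 1 else maj σ⁻¹) := by
    rw [h2]
    split_ifs <;> ring
  rw [B, M, Set.mem_ofPred_eq, Nat.ModEq, Nat.ModEq, parity _ _ h1, parity _ _ h3]
  rfl

end Membership

/-- The gap is `q + 1 - p` for `12` and `p - q` for `21`, while `inv` changes by `p + q` modulo 2.
Hence odd gaps preserve the parity of `inv` for `12`, and even gaps do for `21`. -/
theorem B_eq_union (n i j : ℕ) :
    B (n + 2) i j =
      gapShuffleSet (n + 2) p12 O (B n i j) ∪ gapShuffleSet (n + 2) p12 E (B n (i + 1) j) ∪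
        gapShuffleSet (n + 2) p21 E (B n i (j + 1)) ∪
        gapShuffleSet (n + 2) p21 O (B n (i + 1) (j + 1)) := by
  ext τ
  obtain ⟨p, q, σ, rfl⟩ := exists_insertTwo_eq τ
  simp only [Set.mem_union, insertTwo_mem_p12, insertTwo_mem_p21, insertTwo_mem_B]
  simp only [B, M, O, E, Set.mem_ofPred_eq, Nat.ModEq, Nat.even_iff, Nat.odd_iff]
  split_ifs <;> omega

theorem pairwise_disjoint_gapShuffleSet (n : ℕ) (N₁ N₂ N₃ N₄ : Set (Equiv.Perm (Fin n))) :
    List.Pairwise Disjoint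
      [gapShuffleSet (n + 2) p12 O N₁, gapShuffleSet (n + 2) p12 E N₂,
        gapShuffleSet (n + 2) p21 E N₃, gapShuffleSet (n + 2) p21 O N₄] := by
  have key (S T : Set (Equiv.Perm (Fin (n + 2))))
      (h : ∀ p q σ, insertTwo p q σ ∈ S → insertTwo p q σ ∉ T) : Disjoint S T := by
    rw [Set.disjoint_left]
    intro τ
    obtain ⟨p, q, σ, rfl⟩ := exists_insertTwo_eq τ
    exact h p q σ
  simp only [List.pairwise_cons, List.mem_cons, List.not_mem_nil, or_false, forall_eq_or_imp,
    forall_eq, IsEmpty.forall_iff, implies_true, List.Pairwise.nil, and_true]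
  refine ⟨⟨?_, ?_, ?_⟩, ⟨?_, ?_⟩, ?_⟩ <;> refine key _ _ fun p q σ => ?_ <;>
    simp only [insertTwo_mem_p12, insertTwo_mem_p21, O, E, Set.mem_ofPred_eq, Nat.even_iff,
      Nat.odd_iff] <;>
    omega

/-! ### Recurrences for `b` and `c` -/

theorem b_add_one_add_one (n i j : ℕ) : b (n + 2) i j = b (n + 2) (i + 1) (j + 1) := by
  have h1 := four_mul_b n i j
  have h2 := four_mul_b n (i + 1) (j + 1)
  have h : (-1 : ℤ) ^ (i + 1 + (j + 1)) = (-1) ^ (i + j) := by ring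
  rw [h] at h2
  omega

/-- With `m = n + 2`, the coefficients `2m²` and `2m(m-1)` have sum `2m(2m-1)`, the ratio of
factorials, and difference `2m`, the ratio of signed sums. -/
theorem b_even (n i j : ℕ) :
    b (2 * n + 4) i j = 2 * (n + 2) ^ 2 * b (2 * n + 2) i j +
      2 * (n + 2) * (n + 1) * b (2 * n + 2) (i + 1) j := by
  have h1 := four_mul_b (2 * n + 2) i j
  have h2 := four_mul_b (2 * n) i j
  have h3 := four_mul_b (2 * n) (i + 1) j
  rw [signedMaj_add_two (2 * n + 2), show (2 * n + 2 + 2) / 2 = n + 2 by omega,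
    Nat.factorial_succ, Nat.factorial_succ] at h1
  zify
  push_cast at h1
  apply mul_left_cancel₀ (four_ne_zero (α := ℤ))
  linear_combination h1 - 2 * (n + 2 : ℤ) ^ 2 * h2 - 2 * (n + 2 : ℤ) * (n + 1) * h3

theorem b_odd (n i j : ℕ) :
    b (2 * n + 5) i j = 2 * (n + 2) * (n + 3) * b (2 * n + 3) i j +
      2 * (n + 2) ^ 2 * b (2 * n + 3) (i + 1) j := by
  have h1 := four_mul_b (2 * n + 3) i j
  have h2 := four_mul_b (2 * n + 1) i j
  have h3 := four_mul_b (2 * n + 1) (i + 1) j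
  rw [signedMaj_add_two (2 * n + 3), show (2 * n + 3 + 2) / 2 = n + 2 by omega,
    Nat.factorial_succ, Nat.factorial_succ] at h1
  zify
  push_cast at h1
  apply mul_left_cancel₀ (four_ne_zero (α := ℤ))
  linear_combination h1 - 2 * (n + 2 : ℤ) * (n + 3) * h2 - 2 * (n + 2 : ℤ) ^ 2 * h3

theorem signedMaj_odd : ∀ n : ℕ, signedMaj (2 * n + 1) = signedMaj (2 * n)
  | 0 => by decide
  | n + 1 => by
    rw [show 2 * (n + 1) + 1 = 2 * n + 1 + 2 by ring, show 2 * (n + 1) = 2 * n + 2 by ring,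
      signedMaj_add_two, signedMaj_add_two, signedMaj_odd n,
      show (2 * n + 1 + 2) / 2 = (2 * n + 2) / 2 by omega]

/-- By `signedMaj_odd`, the factorial and the signed sum both grow by the factor `2(n+2)`. -/
theorem b_even_eq_odd (n i j : ℕ) : b (2 * n + 4) i j = 2 * (n + 2) * b (2 * n + 3) i j := by
  have h1 := four_mul_b (2 * n + 2) i j
  have h2 := four_mul_b (2 * n + 1) i j
  rw [signedMaj_add_two (2 * n + 2), show (2 * n + 2 + 2) / 2 = n + 2 by omega,
    Nat.factorial_succ] at h1
  rw [show 2 * n + 1 + 2 = 2 * (n + 1) + 1 by ring, signedMaj_odd] at h2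
  zify
  push_cast at h1
  apply mul_left_cancel₀ (four_ne_zero (α := ℤ))
  linear_combination h1 - 2 * (n + 2 : ℤ) * h2

theorem c_even_eq (n i j : ℕ) :
    c (2 * n + 2) i j = (b (2 * n + 2) i j : ℚ) / (2 ^ n * (n + 1).factorial) := by
  rw [c, show (2 * n + 2) / 2 = n + 1 by omega, Nat.add_sub_cancel]
  push_cast
  rfl

theorem c_odd_eq (n i j : ℕ) :
    c (2 * n + 3) i j = (b (2 * n + 3) i j : ℚ) / (2 ^ n * (n + 1).factorial) := by
  rw [c, show (2 * n + 3) / 2 = n + 1 by omega, Nat.add_sub_cancel]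
  push_cast
  rfl

theorem c_even (n i j : ℕ) :
    c (2 * n + 4) i j = (n + 2) * c (2 * n + 2) i j + (n + 1) * c (2 * n + 2) (i + 1) j := by
  rw [show 2 * n + 4 = 2 * (n + 1) + 2 by ring, c_even_eq, c_even_eq, c_even_eq,
    show 2 * (n + 1) + 2 = 2 * n + 4 by ring, b_even, Nat.factorial_succ (n + 1)]
  have : ((n + 1).factorial : ℚ) ≠ 0 := by positivity
  push_cast
  field_simp
  ring

theorem c_odd (n i j : ℕ) :
    c (2 * n + 5) i j = (n + 3) * c (2 * n + 3) i j + (n + 2) * c (2 * n + 3) (i + 1) j := by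
  rw [show 2 * n + 5 = 2 * (n + 1) + 3 by ring, c_odd_eq, c_odd_eq, c_odd_eq,
    show 2 * (n + 1) + 3 = 2 * n + 5 by ring, b_odd, Nat.factorial_succ (n + 1)]
  have : ((n + 1).factorial : ℚ) ≠ 0 := by positivity
  push_cast
  field_simp
  ring

/-- The recurrence has integer coefficients, and the first denominator is `2^0 * 1! = 1`. -/
theorem exists_int_c_even (n : ℕ) : ∀ i j, ∃ z : ℤ, c (2 * n + 2) i j = z := by
  induction n with
  | zero => exact fun i j => ⟨b 2 i j, by simp [c]⟩
  | succ n ih =>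
    intro i j
    obtain ⟨x, hx⟩ := ih i j
    obtain ⟨y, hy⟩ := ih (i + 1) j
    refine ⟨(n + 2) * x + (n + 1) * y, ?_⟩
    rw [show 2 * (n + 1) + 2 = 2 * n + 4 by ring, c_even, hx, hy]
    push_cast
    rfl

theorem exists_int_c_odd (n : ℕ) : ∀ i j, ∃ z : ℤ, c (2 * n + 3) i j = z := by
  induction n with
  | zero => exact fun i j => ⟨b 3 i j, by simp [c]⟩
  | succ n ih =>
    intro i j
    obtain ⟨x, hx⟩ := ih i j
    obtain ⟨y, hy⟩ := ih (i + 1) j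
    refine ⟨(n + 3) * x + (n + 2) * y, ?_⟩
    rw [show 2 * (n + 1) + 3 = 2 * n + 5 by ring, c_odd, hx, hy]
    push_cast
    rfl

theorem exists_int_c (n i j : ℕ) : ∃ z : ℤ, c (n + 2) i j = z := by
  obtain ⟨k, rfl | rfl⟩ := n.even_or_odd'
  · exact exists_int_c_even k i j
  · exact exists_int_c_odd k i j

end MajShuffle

theorem theorem5p5 (n : ℕ) (hn : 2 ≤ n) :
    -- `b_n` is also the matrix of cardinalities of `B_n`
    (∀ i j : ℕ, (B n i j).ncard = b n i j) ∧
    -- (1) the decomposition, a disjoint union of four sets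
    (∀ i j : ℕ,
      B n i j =
        gapShuffleSet n p12 O (B (n - 2) i j) ∪
        gapShuffleSet n p12 E (B (n - 2) (i + 1) j) ∪
        gapShuffleSet n p21 E (B (n - 2) i (j + 1)) ∪
        gapShuffleSet n p21 O (B (n - 2) (i + 1) (j + 1)) ∧
      List.Pairwise Disjoint
        [gapShuffleSet n p12 O (B (n - 2) i j),
         gapShuffleSet n p12 E (B (n - 2) (i + 1) j),
         gapShuffleSet n p21 E (B (n - 2) i (j + 1)),
         gapShuffleSet n p21 O (B (n - 2) (i + 1) (j + 1))]) ∧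
    -- (2) the recurrences for `b`
    (∀ i j : ℕ,
      b (2 * n) i j =
        2 * n ^ 2 * b (2 * n - 2) i j +
          2 * n * (n - 1) * b (2 * n - 2) (i + 1) j ∧
      b (2 * n + 1) i j =
        2 * n * (n + 1) * b (2 * n - 1) i j +
          2 * n ^ 2 * b (2 * n - 1) (i + 1) j) ∧
    -- (3) the matrices `c` have integer entries, and their recurrences
    (∀ i j : ℕ,
      (∃ z : ℤ, c n i j = (z : ℚ)) ∧
      (∃ z : ℤ, c (2 * n) i j = (z : ℚ)) ∧
      (∃ z : ℤ, c (2 * n + 1) i j = (z : ℚ)) ∧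
      c (2 * n) i j =
        (n : ℚ) * c (2 * n - 2) i j +
          ((n : ℚ) - 1) * c (2 * n - 2) (i + 1) j ∧
      c (2 * n + 1) i j =
        ((n : ℚ) + 1) * c (2 * n - 1) i j +
          (n : ℚ) * c (2 * n - 1) (i + 1) j) ∧
    -- (4)
    (∀ i j : ℕ, b n i j = b n (i + 1) (j + 1)) ∧
    -- (5)
    (∀ i j : ℕ, b (2 * n) i j = 2 * n * b (2 * n - 1) i j) := by
  obtain ⟨k, rfl⟩ := Nat.exists_eq_add_of_le' hn
  have e0 : 2 * (k + 2) = 2 * k + 4 := by ring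
  have e1 : 2 * (k + 2) + 1 = 2 * k + 5 := by ring
  have e2 : 2 * (k + 2) - 2 = 2 * k + 2 := by omega
  have e3 : 2 * (k + 2) - 1 = 2 * k + 3 := by omega
  refine ⟨ncard_B k, fun i j => ⟨B_eq_union k i j, pairwise_disjoint_gapShuffleSet k _ _ _ _⟩,
    fun i j => ⟨?_, ?_⟩,
    fun i j => ⟨exists_int_c k i j, exists_int_c (2 * k + 2) i j, exists_int_c (2 * k + 3) i j,
      ?_, ?_⟩, b_add_one_add_one k, fun i j => ?_⟩
  · rw [e2, show b (2 * (k + 2)) i j = _ from b_even k i j]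
    -- The truncated subtraction `k + 2 - 1` reduces to `k + 1`.
    rfl
  · rw [e1, e3, b_odd]
  · rw [e2, show c (2 * (k + 2)) i j = _ from c_even k i j]
    push_cast
    ring
  · rw [e1, e3, c_odd]
    push_cast
    ring
  · rw [e3, show b (2 * (k + 2)) i j = _ from b_even_eq_odd k i j]
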